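/- **Proposition (Pathwise uniqueness).** Let $d\in\{2,3\}$ and let $\mathcal D=\mathbb R^d/(2\pi\mathbb Z)^d$. Let $H$ be the space of vector fields $u\in[L^2(\mathcal D)]^d$ with $\operatorname{div}u=0$ and $\int_{\mathcal D}u\,d\xi=0$, with the $L^2$ inner product. Let $A=-\Delta$ be the Stokes operator on $H$, with domain $D(A)=[H^2(\mathcal D)]^d\cap H$. For $s\in\mathbb R$ let $A^s$ be its power: if $(e_j)$ is an orthonormal basis of $H$ with $Ae_j=\lambda_je_j$, then $A^su=\sum_j\lambda_j^s\langle u,e_j\rangle e_j$ for $u\in D(A^s)=\{u\in H:\sum_j\lambda_j^{2s}\langle u,e_j\rangle^2<\infty\}$ (only elements of $H$ are considered). Let $B$ be the bilinear operator given by $\langle B(u,v),z\rangle=\int_{\mathcal D}z\cdot[(u\cdot\nabla)v]\,d\xi$. Let $\nu>0$, $T>0$, $\gamma=-\tfrac12$ and $\alpha>\tfrac d2+1$. Let $w$ be a cylindrical Wiener process in $H$ on a filtered probability space $(\Omega,F,\{F_t\}_{t\ge0},P)$, i.e. $w(t)=\sum_j\beta_j(t)h_j$, where $(h_j)$ is an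 orthonormal basis of $H$ and the $\beta_j$ are independent one-dimensional $\{F_t\}$-Wiener processes; for $h\in H$ write $\langle w(t),h\rangle=\sum_j\beta_j(t)\langle h_j,h\rangle$, with convergence in $L^2(\Omega)$. Let $x\in D(A)$ and consider the modified stochastic Navier–Stokes equation $$du(t)+\big[\nu A^\alpha u(t)+B(u(t),u(t))\big]\,dt=A^\gamma\,dw(t),\quad t\in\,]0,T],\qquad u(0)=x.$$ A $C([0,T];D(A))$-valued strong solution is an $\{F_t\}$-adapted process $u=\{u(t)\}_{0\le t\le T}$ on the given probability space, almost all of whose paths belong to $C([0,T];D(A))$, such that $u(0)=x$ $P$-a.s. and, for every $\varphi\in D(A^\alpha)\cap D(A^\gamma)$ and every $t\in[0,T]$, $P$-a.s. $$\langle u(t),\varphi\rangle=\langle x,\varphi\rangle-\nu\int_0^t\langle u(s),A^\alpha\varphi\rangle\,ds-\int_0^t\langle B(u(s),u(s)),\varphi\rangle\,ds+\langle w(t),A^\gamma\varphi\rangle .$$ Then any two $C([0,T];D(A))$-valued strong solutions $u_1,u_2$ with the same initial value $x$ and the same $w$ coincide almost surely: $$P\big(u_1(t)=u_2(t)\ \text{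 for all } t\in[0,T]\big)=1 .$$ -/

import Mathlib

open MeasureTheory ProbabilityTheory Filter Topology
open scoped NNReal ENNReal InnerProductSpace

noncomputable section

namespace ModifiedNS

instance factTwoPiPos : Fact ((0 : ℝ) < 2 * Real.pi) := ⟨Real.two_pi_pos⟩

/-! ### The torus, test functions and weak derivatives -/

/-- The `d`-dimensional torus `(ℝ / 2πℤ)^d`, with Lebesgue measure `volume` of total mass
`(2π)^d`. -/
abbrev Torus (d : ℕ) : Type := Fin d → AddCircle (2 * Real.pi)

/-- The projection `ℝ^d → (ℝ / 2πℤ)^d`. -/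
def proj (d : ℕ) (x : Fin d → ℝ) : Torus d := fun i => (x i : AddCircle (2 * Real.pi))

/-- Smooth functions on the torus, i.e. those whose periodic lift to `ℝ^d` is smooth. -/
def IsTest {d : ℕ} (φ : Torus d → ℝ) : Prop :=
  ContDiff ℝ (⊤ : ℕ∞) (fun x : Fin d → ℝ => φ (proj d x))

/-- The classical partial derivative `∂_i φ` of a function on the torus. -/
def pderiv {d : ℕ} (i : Fin d) (φ : Torus d → ℝ) (ξ : Torus d) : ℝ :=
  deriv (fun t : ℝ => φ (ξ + proj d (Pi.single i t))) 0

lemma isOpenQuotientMap_proj (d : ℕ) : IsOpenQuotientMap (proj d) :=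
  IsOpenQuotientMap.piMap (fun _ : Fin d =>
    (QuotientAddGroup.isOpenQuotientMap_mk :
      IsOpenQuotientMap (fun x : ℝ => (x : AddCircle (2 * Real.pi)))))

lemma proj_add {d : ℕ} (x y : Fin d → ℝ) : proj d (x + y) = proj d x + proj d y := by
  funext i; simp [proj]

lemma IsTest.continuous {d : ℕ} {φ : Torus d → ℝ} (hφ : IsTest φ) : Continuous φ :=
  (isOpenQuotientMap_proj d).isQuotientMap.continuous_iff.2 (ContDiff.continuous hφ)

lemma IsTest.pderiv_proj {d : ℕ} {φ : Torus d → ℝ} (hφ : IsTest φ) (i : Fin d)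
    (x : Fin d → ℝ) :
    pderiv i φ (proj d x) = fderiv ℝ (fun y => φ (proj d y)) x (Pi.single i 1) := by
  have hd : DifferentiableAt ℝ (fun y => φ (proj d y)) x :=
    (ContDiff.differentiable hφ (by simp)) x
  have h : pderiv i φ (proj d x) = lineDeriv ℝ (fun y => φ (proj d y)) x (Pi.single i 1) := by
    simp only [pderiv, lineDeriv, proj_add]
    congr 1
    funext t
    congr 3
    rw [← Pi.single_smul, smul_eq_mul, mul_one]
  rw [h, hd.lineDeriv_eq_fderiv]

lemma IsTest.continuous_pderiv {d : ℕ} {φ : Torus d → ℝ} (hφ : IsTest φ) (i : Fin d) :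
    Continuous (pderiv i φ) := by
  refine (isOpenQuotientMap_proj d).isQuotientMap.continuous_iff.2 ?_
  have h : pderiv i φ ∘ proj d
      = fun x => fderiv ℝ (fun y => φ (proj d y)) x (Pi.single i 1) := by
    funext x; exact hφ.pderiv_proj i x
  rw [h]
  exact (ContDiff.continuous_fderiv hφ (by simp)).clm_apply continuous_const

/-- Square integrable vector fields `[L²(𝒟)]^d` on the torus. -/
abbrev L2Field (d : ℕ) : Type :=
  Lp (EuclideanSpace ℝ (Fin d)) 2 (volume : Measure (Torus d))

lemma integrable_field {d : ℕ} (u : L2Field d) : Integrable (u : Torus d → _) volume :=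
  (Lp.memLp u).integrable (by norm_num)

lemma integrable_smul_field {d : ℕ} {f : Torus d → ℝ} (hf : Continuous f) (u : L2Field d) :
    Integrable (fun ξ => f ξ • u ξ) volume := by
  obtain ⟨C, hC⟩ := isCompact_univ.exists_bound_of_continuousOn hf.continuousOn
  exact (integrable_field u).bdd_smul C hf.aestronglyMeasurable
    (Eventually.of_forall fun ξ => hC ξ (Set.mem_univ ξ))

lemma integrable_mul_coord {d : ℕ} {f : Torus d → ℝ} (hf : Continuous f) (u : L2Field d)
    (i : Fin d) : Integrable (fun ξ => f ξ * u ξ i) volume :=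
  (EuclideanSpace.proj (𝕜 := ℝ) i).integrable_comp (integrable_smul_field hf u)

/-- `g = ∂_i u` in the weak sense (componentwise) on the torus. -/
def HasWeakDeriv {d : ℕ} (i : Fin d) (u g : L2Field d) : Prop :=
  ∀ φ : Torus d → ℝ, IsTest φ → ∫ ξ, pderiv i φ ξ • u ξ = - ∫ ξ, φ ξ • g ξ

open Classical in
/-- The weak derivative `∂_i u ∈ L²` of `u`, when there is one (and `0` otherwise). -/
def weakDeriv {d : ℕ} (i : Fin d) (u : L2Field d) : L2Field d :=
  if h : ∃ g, HasWeakDeriv i u g then h.choose else 0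

/-! ### The space `H`, the Stokes operator and its powers, the bilinear operator -/

/-- `div u = 0` in the weak sense on the torus. -/
def IsDivFree {d : ℕ} (u : L2Field d) : Prop :=
  ∀ φ : Torus d → ℝ, IsTest φ → ∫ ξ, ∑ i, pderiv i φ ξ * u ξ i = 0

/-- The space `H` of square integrable, divergence free, mean zero vector fields on the torus,
with the `L²` inner product. -/
def H (d : ℕ) : Submodule ℝ (L2Field d) where
  carrier := {u | ∫ ξ, u ξ = 0 ∧ IsDivFree u}
  zero_mem' := by
    have h0 := Lp.coeFn_zero (EuclideanSpace ℝ (Fin d)) 2 (volume : Measure (Torus d))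
    refine ⟨?_, fun φ _ => ?_⟩
    · rw [integral_congr_ae h0]; simp
    · rw [integral_congr_ae (g := fun _ => (0 : ℝ))]
      · simp
      · filter_upwards [h0] with ξ hξ
        rw [hξ]; simp
  add_mem' := by
    rintro u v ⟨hu, hu'⟩ ⟨hv, hv'⟩
    have h := Lp.coeFn_add u v
    refine ⟨?_, fun φ hφ => ?_⟩
    · rw [integral_congr_ae h]
      simp only [Pi.add_apply]
      rw [integral_add (integrable_field u) (integrable_field v), hu, hv, add_zero]
    · rw [integral_congr_ae
        (g := fun ξ => (∑ i, pderiv i φ ξ * u ξ i) + ∑ i, pderiv i φ ξ * v ξ i),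
        integral_add, hu' φ hφ, hv' φ hφ, add_zero]
      · exact integrable_finsetSum _ fun i _ => integrable_mul_coord (hφ.continuous_pderiv i) u i
      · exact integrable_finsetSum _ fun i _ => integrable_mul_coord (hφ.continuous_pderiv i) v i
      · filter_upwards [h] with ξ hξ
        rw [hξ]; simp [mul_add, Finset.sum_add_distrib]
  smul_mem' := by
    rintro c u ⟨hu, hu'⟩
    have h := Lp.coeFn_smul c u
    refine ⟨?_, fun φ hφ => ?_⟩
    · rw [integral_congr_ae h]
      simp only [Pi.smul_apply]
      rw [integral_smul, hu, smul_zero]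
    · rw [integral_congr_ae (g := fun ξ => c * ∑ i, pderiv i φ ξ * u ξ i),
        integral_const_mul, hu' φ hφ, mul_zero]
      filter_upwards [h] with ξ hξ
      rw [hξ, Finset.mul_sum]
      exact Finset.sum_congr rfl fun i _ => by simp; ring

/-- The Stokes operator, as a relation: `u ∈ D(A) = [H²]^d ∩ H` and `f = A u = -Δ u`. -/
def IsStokes {d : ℕ} (u f : H d) : Prop :=
  ∃ (g : Fin d → L2Field d) (h : Fin d → Fin d → L2Field d),
    (∀ i, HasWeakDeriv i u (g i)) ∧ (∀ i j, HasWeakDeriv j (g i) (h i j)) ∧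
      (f : L2Field d) = - ∑ i, h i i

/-- The domain `D(A)` of the Stokes operator. -/
def stokesDomain (d : ℕ) : Set (H d) := {u | ∃ f, IsStokes u f}

/-- The real powers of the Stokes operator, as a relation: `u ∈ D(A^s)` and `f = A^s u`, i.e.
`⟨f, e⟩ = l^s ⟨u, e⟩` for every eigenvector `e` of `A`, `l` being its eigenvalue. For an
orthonormal basis `(e_j)` of eigenvectors with eigenvalues `l_j` this says
`∑ l_j^(2s) ⟨u, e_j⟩² < ∞` and `f = ∑ l_j^s ⟨u, e_j⟩ e_j`. -/
def IsStokesPow {d : ℕ} (s : ℝ) (u f : H d) : Prop :=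
  ∀ (l : ℝ) (e : H d), IsStokes e (l • e) → ⟪f, e⟫_ℝ = l ^ s * ⟪u, e⟫_ℝ

/-- `⟨B(u,v), z⟩ = ∫ z · [(u · ∇) v] dξ`. -/
def bform {d : ℕ} (u v z : H d) : ℝ :=
  ∫ ξ, ∑ i, (u : L2Field d) ξ i *
    ⟪(weakDeriv i (v : L2Field d)) ξ, (z : L2Field d) ξ⟫_ℝ

/-! ### Noise and solutions -/

/-- `b` is a one dimensional Wiener process with respect to the filtration `𝓕`. -/
structure IsWiener {Ω : Type*} [mΩ : MeasurableSpace Ω] (P : Measure Ω)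
    (𝓕 : Filtration ℝ≥0 mΩ) (b : ℝ≥0 → Ω → ℝ) : Prop where
  brownian : IsBrownianReal b P
  adapted : ∀ t, StronglyMeasurable[𝓕 t] (b t)
  indep : ∀ s t, s ≤ t →
    Indep (MeasurableSpace.comap (fun ω => b t ω - b s ω) inferInstance) (𝓕 s) P

/-- `w` is a cylindrical Wiener process in `H`: there are an orthonormal basis `(e_j)` of `H` and
independent Wiener processes `(β_j)` with `w(t) = ∑ β_j(t) e_j`. The series does not converge in
`H`; it is understood through its pairings `w t h = ∑ β_j(t) ⟨e_j, h⟩` with the elements `h`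
of `H`, which converge in `L²(Ω)`. -/
def IsCylindricalWiener {d : ℕ} {Ω : Type*} [mΩ : MeasurableSpace Ω] (P : Measure Ω)
    (𝓕 : Filtration ℝ≥0 mΩ) (w : ℝ≥0 → H d → Ω → ℝ) : Prop :=
  ∃ (e : HilbertBasis ℕ ℝ (H d)) (β : ℕ → ℝ≥0 → Ω → ℝ),
    (∀ j, IsWiener P 𝓕 (β j)) ∧
    iIndepFun (fun j ω t => β j t ω) P ∧
    ∀ t h, MemLp (w t h) 2 P ∧
      Tendsto (fun n => eLpNorm
        (fun ω => w t h ω - ∑ j ∈ Finset.range n, β j t ω * ⟪e j, h⟫_ℝ) 2 P) atTop (𝓝 0)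

/-- `u` belongs to `C([0,T]; D(A))`, where `D(A)` carries the norm `|A u|_H`, which is equivalent
to the graph norm. -/
def IsDomainPath {d : ℕ} (T : ℝ) (u : ℝ → H d) : Prop :=
  ∃ Au : ℝ → H d, (∀ t ∈ Set.Icc 0 T, IsStokes (u t) (Au t)) ∧ ContinuousOn Au (Set.Icc 0 T)

/-- `u` is a `C([0,T]; D(A))`-valued strong solution, with initial value `x` and driven by the
given `w`, of `du + [ν A^α u + B(u,u)] dt = A^γ dw`. The values of `u` at times outside `[0,T]`
are irrelevant. The equation is in integrated form, and tested with the elements `φ` of `D(A^α)`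
and `D(A^γ)`; here `ψ = A^α φ` and `χ = A^γ φ`. -/
structure IsStrongSolution {d : ℕ} {Ω : Type*} [mΩ : MeasurableSpace Ω] (P : Measure Ω)
    (𝓕 : Filtration ℝ≥0 mΩ) (w : ℝ≥0 → H d → Ω → ℝ) (ν α γ T : ℝ) (x : H d)
    (u : ℝ → Ω → H d) : Prop where
  adapted : ∀ t : ℝ≥0, (t : ℝ) ≤ T → StronglyMeasurable[𝓕 t] (u t)
  paths : ∀ᵐ ω ∂P, IsDomainPath T (fun t => u t ω)
  initial : ∀ᵐ ω ∂P, u 0 ω = x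
  equation : ∀ φ ψ χ : H d, IsStokesPow α φ ψ → IsStokesPow γ φ χ →
    ∀ t : ℝ≥0, (t : ℝ) ≤ T → ∀ᵐ ω ∂P,
      ⟪u t ω, φ⟫_ℝ = ⟪x, φ⟫_ℝ - ν * (∫ s in (0 : ℝ)..t, ⟪u s ω, ψ⟫_ℝ)
        - (∫ s in (0 : ℝ)..t, bform (u s ω) (u s ω) φ) + w t χ ω

end ModifiedNS

end

/-!
The noise is additive, so it cancels in the difference `v = u₁ - u₂` of two solutions, and the
claim becomes a deterministic uniqueness statement for almost every path.

The equation is tested with the divergence free plane waves `testField`. They are eigenvectors of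
every power of the Stokes operator (`isStokesPow_testField`), they are bounded by `1`, and their
pairings with `v` are the components of the Fourier coefficients of `v`. Every such component `y` of
frequency `n` solves `y' = -ν |n|^(2α) y - N` with `y(0) = 0`, where `N` is the difference of the
nonlinear terms, so that `y(t)² ≤ (2 ν |n|^(2α))⁻¹ ∫₀ᵗ N²` (`sq_le_integral_sq`). As the test fields
are bounded and `u₁`, `u₂` are bounded in `D(A)`, writing
`B(u₁,u₁) - B(u₂,u₂) = B(v,u₁) + B(u₂,v)` gives `N² ≤ C |∇v|²` with `C` independent of the
frequency (`sq_bform_sub_bform_le`); neither a Sobolev embedding nor the cancellation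
`⟨B(u,v),v⟩ = 0` is needed.

By Parseval's identity on the torus (`hasSum_modeSq`, `IsStokes.hasSum_gradSq`), multiplying by
`|n|²` and summing over `n` bounds `|∇v(t)|²` by a multiple of `(∑ |n|^(2 - 2α)) ∫₀ᵗ |∇v|²`. The
series converges because `α > d/2 + 1` (`summable_freqSq_rpow`), and Grönwall's inequality
yields `v = 0` (`eq_of_mode_equations`).
-/

noncomputable section

namespace ModifiedNS

/-! ### Real plane waves -/

/-- The real plane wave `ξ ↦ cos (n · ξ + b)` on the torus, with frequency `n` and phase `b`. -/
def wave {d : ℕ} (n : Fin d → ℤ) (b : ℝ) (ξ : Torus d) : ℝ :=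
  ((∏ i, (fourier (n i) (ξ i) : ℂ)) * Complex.exp (b * Complex.I)).re

lemma wave_proj {d : ℕ} (n : Fin d → ℤ) (b : ℝ) (x : Fin d → ℝ) :
    wave n b (proj d x) = Real.cos (∑ i, n i * x i + b) := by
  have h : ∀ i, (fourier (n i) (proj d x i) : ℂ)
      = Complex.exp ((n i * x i : ℝ) * Complex.I) := by
    intro i
    have hpi : (Real.pi : ℂ) ≠ 0 := by exact_mod_cast Real.pi_ne_zero
    rw [proj, fourier_coe_apply]
    congr 1
    push_cast
    field_simp
  simp only [wave, h]
  rw [← Complex.exp_sum, ← Complex.exp_add, ← Finset.sum_mul, ← add_mul]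
  rw [show (∑ i, ((n i * x i : ℝ) : ℂ)) + (b : ℂ) = ((∑ i, n i * x i + b : ℝ) : ℂ) by
    push_cast; rfl]
  rw [Complex.exp_ofReal_mul_I_re]

lemma proj_surjective (d : ℕ) : Function.Surjective (proj d) :=
  (isOpenQuotientMap_proj d).surjective

lemma isTest_wave {d : ℕ} (n : Fin d → ℤ) (b : ℝ) : IsTest (wave n b) := by
  unfold IsTest
  simp only [wave_proj]
  fun_prop

lemma abs_wave_le {d : ℕ} (n : Fin d → ℤ) (b : ℝ) (ξ : Torus d) : |wave n b ξ| ≤ 1 := by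
  obtain ⟨x, rfl⟩ := proj_surjective d ξ
  rw [wave_proj]
  exact Real.abs_cos_le_one _

lemma wave_add_proj {d : ℕ} (n : Fin d → ℤ) (b : ℝ) (ξ : Torus d) (y : Fin d → ℝ) :
    wave n b (ξ + proj d y) = wave n (b + ∑ i, n i * y i) ξ := by
  obtain ⟨x, rfl⟩ := proj_surjective d ξ
  rw [← proj_add, wave_proj, wave_proj]
  congr 1
  simp only [Pi.add_apply, mul_add, Finset.sum_add_distrib]
  ring

lemma wave_add_pi {d : ℕ} (n : Fin d → ℤ) (b : ℝ) (ξ : Torus d) :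
    wave n (b + Real.pi) ξ = - wave n b ξ := by
  obtain ⟨x, rfl⟩ := proj_surjective d ξ
  rw [wave_proj, wave_proj, ← add_assoc, Real.cos_add_pi]

lemma pderiv_wave {d : ℕ} (n : Fin d → ℤ) (b : ℝ) (i : Fin d) (ξ : Torus d) :
    pderiv i (wave n b) ξ = n i * wave n (b + Real.pi / 2) ξ := by
  obtain ⟨x, rfl⟩ := proj_surjective d ξ
  have h : (fun t : ℝ => wave n b (proj d x + proj d (Pi.single i t)))
      = fun t => Real.cos (∑ j, n j * x j + b + n i * t) := by
    funext t
    rw [wave_add_proj, wave_proj]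
    have h1 : ∑ j, (n j : ℝ) * (Pi.single i t : Fin d → ℝ) j = n i * t := by
      simp [Pi.single_apply]
    rw [h1]
    congr 1
    ring
  rw [pderiv, h, wave_proj, ← add_assoc, Real.cos_add_pi_div_two]
  have h1 : HasDerivAt (fun t : ℝ => Real.cos (∑ j, n j * x j + b + n i * t))
      (- Real.sin (∑ j, n j * x j + b + n i * 0) * n i) 0 := by
    have := (((hasDerivAt_id (0 : ℝ)).const_mul (n i : ℝ)).const_add
      (∑ j, n j * x j + b)).cos
    simpa using this
  rw [h1.deriv]
  simp
  ring

lemma wave_zero {d : ℕ} (b : ℝ) (ξ : Torus d) : wave 0 b ξ = Real.cos b := by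
  obtain ⟨x, rfl⟩ := proj_surjective d ξ
  rw [wave_proj]
  simp

/-! ### Parseval's identity on the torus of side `2π` -/

/-- The rescaling `(ℝ / ℤ)^d → (ℝ / 2πℤ)^d`. -/
def rescale (d : ℕ) (x : UnitAddTorus (Fin d)) : Torus d := fun i =>
  AddCircle.equivAddCircle 1 (2 * Real.pi) one_ne_zero Real.two_pi_pos.ne' (x i)

-- Mathlib states Fourier theory on `UnitAddTorus` for the normalised Haar measure, by means of
-- this `MeasureSpace` instance, which is local there.
attribute [local instance] instMeasureSpaceUnitAddCircle in
lemma measurePreserving_rescale (d : ℕ) :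
    MeasurePreserving (rescale d) (volume : Measure (UnitAddTorus (Fin d)))
      (Measure.pi fun _ => AddCircle.haarAddCircle) := by
  refine measurePreserving_pi _ _ fun _ => ?_
  have hc : Continuous (AddCircle.equivAddCircle (1 : ℝ) (2 * Real.pi) one_ne_zero
      Real.two_pi_pos.ne') :=
    (AddCircle.homeomorphAddCircle (1 : ℝ) (2 * Real.pi) one_ne_zero
      Real.two_pi_pos.ne').continuous
  exact AddMonoidHom.measurePreserving (μ := AddCircle.haarAddCircle)
    (ν := AddCircle.haarAddCircle)
    (f := (AddCircle.equivAddCircle (1 : ℝ) (2 * Real.pi) one_ne_zero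
      Real.two_pi_pos.ne').toAddMonoidHom) hc (AddEquiv.surjective _) (by simp)

lemma measurableEmbedding_rescale (d : ℕ) : MeasurableEmbedding (rescale d) :=
  (Homeomorph.piCongrRight fun _ : Fin d => AddCircle.homeomorphAddCircle (1 : ℝ) (2 * Real.pi)
    one_ne_zero Real.two_pi_pos.ne').measurableEmbedding

lemma volume_torus (d : ℕ) : (volume : Measure (Torus d))
    = ENNReal.ofReal ((2 * Real.pi) ^ d) • Measure.pi fun _ => AddCircle.haarAddCircle := by
  rw [volume_pi]
  refine Measure.pi_eq fun s _ => ?_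
  rw [Measure.smul_apply, Measure.pi_pi]
  simp_rw [AddCircle.volume_eq_smul_haarAddCircle, Measure.smul_apply, smul_eq_mul]
  rw [Finset.prod_mul_distrib, Finset.prod_const, ENNReal.ofReal_pow Real.two_pi_pos.le]
  simp

attribute [local instance] instMeasureSpaceUnitAddCircle in
lemma integral_comp_rescale {d : ℕ} {E : Type*} [NormedAddCommGroup E] [NormedSpace ℝ E]
    (f : Torus d → E) :
    ∫ x : UnitAddTorus (Fin d), f (rescale d x) = ((2 * Real.pi) ^ d)⁻¹ • ∫ ξ, f ξ := by
  rw [(measurePreserving_rescale d).integral_comp (measurableEmbedding_rescale d), volume_torus,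
    integral_smul_measure, ENNReal.toReal_ofReal (by positivity), smul_smul,
    inv_mul_cancel₀ (by positivity), one_smul]

/-- The complex exponential `exp (-i n · ξ)` is `cos (n · ξ) + i cos (n · ξ + π / 2)`. -/
lemma mFourier_neg_eq {d : ℕ} (n : Fin d → ℤ) (x : UnitAddTorus (Fin d)) :
    UnitAddTorus.mFourier (-n) x =
      wave n 0 (rescale d x) + wave n (Real.pi / 2) (rescale d x) * Complex.I := by
  have h : ∀ i, (fourier (n i) (rescale d x i) : ℂ) = fourier (n i) (x i) := by
    intro i
    unfold rescale
    induction x i using QuotientAddGroup.induction_on with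
    | H y =>
      erw [AddCircle.equivAddCircle_apply_mk, fourier_coe_apply, fourier_coe_apply]
      congr 1
      have hpi : (Real.pi : ℂ) ≠ 0 := by exact_mod_cast Real.pi_ne_zero
      push_cast
      field_simp
  rw [UnitAddTorus.mFourier_neg]
  have h1 : UnitAddTorus.mFourier n x = ∏ i, (fourier (n i) (x i) : ℂ) := rfl
  simp only [wave, h, ← h1]
  have h2 : Complex.exp (((Real.pi / 2 : ℝ) : ℂ) * Complex.I) = Complex.I := by
    push_cast
    exact Complex.exp_pi_div_two_mul_I
  rw [h2]
  apply Complex.ext <;> simp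

attribute [local instance] instMeasureSpaceUnitAddCircle in
/-- Parseval's identity for real functions, by rescaling to the torus of side `1`. -/
lemma hasSum_wave_coeff {d : ℕ} {f : Torus d → ℝ} (hf : MemLp f 2 volume) :
    HasSum (fun n : Fin d → ℤ => (∫ ξ, wave n 0 ξ * f ξ) ^ 2
      + (∫ ξ, wave n (Real.pi / 2) ξ * f ξ) ^ 2) ((2 * Real.pi) ^ d * ∫ ξ, f ξ ^ 2) := by
  have hp : (0 : ℝ) < (2 * Real.pi) ^ d := by positivity
  have hf' : MemLp f 2 (Measure.pi fun _ => AddCircle.haarAddCircle) := by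
    refine hf.of_measure_le_smul (c := ENNReal.ofReal ((2 * Real.pi) ^ d)⁻¹) (by simp) ?_
    rw [volume_torus, smul_smul, ← ENNReal.ofReal_mul (by positivity),
      inv_mul_cancel₀ hp.ne']
    simp
  have hF : MemLp (fun x => ((f (rescale d x) : ℝ) : ℂ)) 2
      (volume : Measure (UnitAddTorus (Fin d))) :=
    (hf'.comp_measurePreserving (measurePreserving_rescale d)).ofReal
  have hi : ∀ n : Fin d → ℤ, ∀ b, Integrable (fun ξ => wave n b ξ * f ξ) volume := by
    intro n b
    refine (hf.integrable (by norm_num)).bdd_mul (c := 1)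
      (isTest_wave n b).continuous.aestronglyMeasurable
      (Eventually.of_forall fun ξ => ?_)
    exact abs_wave_le n b ξ
  have key := UnitAddTorus.hasSum_sq_mFourierCoeff (hF.toLp _)
  have hae := hF.coeFn_toLp
  have hnorm : ∫ x, ‖hF.toLp _ x‖ ^ 2 = ((2 * Real.pi) ^ d)⁻¹ * ∫ ξ, f ξ ^ 2 := by
    rw [← smul_eq_mul, ← integral_comp_rescale]
    refine integral_congr_ae ?_
    filter_upwards [hae] with x hx
    rw [hx]
    simp
  have hcoef : ∀ n : Fin d → ℤ, UnitAddTorus.mFourierCoeff (hF.toLp _) n =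
      ((2 * Real.pi) ^ d)⁻¹ • (((∫ ξ, wave n 0 ξ * f ξ : ℝ) : ℂ)
        + ((∫ ξ, wave n (Real.pi / 2) ξ * f ξ : ℝ) : ℂ) * Complex.I) := by
    intro n
    have : UnitAddTorus.mFourierCoeff (hF.toLp _) n = ∫ x : UnitAddTorus (Fin d),
        (fun ξ => ((wave n 0 ξ * f ξ : ℝ) : ℂ)
          + ((wave n (Real.pi / 2) ξ * f ξ : ℝ) : ℂ) * Complex.I) (rescale d x) := by
      refine integral_congr_ae ?_
      filter_upwards [hae] with x hx
      rw [hx, mFourier_neg_eq]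
      simp
      ring
    refine this.trans ((integral_comp_rescale (E := ℂ) (fun ξ => ((wave n 0 ξ * f ξ : ℝ) : ℂ)
      + ((wave n (Real.pi / 2) ξ * f ξ : ℝ) : ℂ) * Complex.I)).trans ?_)
    rw [integral_add (hi n 0).ofReal ((hi n _).ofReal.mul_const _), integral_mul_const,
      integral_complex_ofReal, integral_complex_ofReal]
  rw [hnorm] at key
  have key2 := key.mul_left (((2 * Real.pi) ^ d) ^ 2)
  have hval : ((2 * Real.pi) ^ d) ^ 2 * (((2 * Real.pi) ^ d)⁻¹ * ∫ ξ, f ξ ^ 2)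
      = (2 * Real.pi) ^ d * ∫ ξ, f ξ ^ 2 := by
    field_simp
  rw [hval] at key2
  have hfun : (fun n : Fin d → ℤ => (∫ ξ, wave n 0 ξ * f ξ) ^ 2
      + (∫ ξ, wave n (Real.pi / 2) ξ * f ξ) ^ 2) = fun n => ((2 * Real.pi) ^ d) ^ 2
        * ‖UnitAddTorus.mFourierCoeff (hF.toLp _) n‖ ^ 2 := by
    funext n
    rw [hcoef, norm_smul, Real.norm_of_nonneg (by positivity),
      mul_pow (((2 * Real.pi) ^ d)⁻¹), ← Complex.normSq_eq_norm_sq, Complex.normSq_add_mul_I]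
    field_simp
  rw [hfun]
  exact key2

/-! ### Fourier coefficients of vector fields -/

/-- The vector valued Fourier coefficient `∫ cos (n · ξ + b) u(ξ) dξ` of a vector field `u`. The
phases `b = 0` and `b = π / 2` give the cosine and (up to the sign) the sine coefficient. -/
def coeff {d : ℕ} (n : Fin d → ℤ) (b : ℝ) (u : L2Field d) : EuclideanSpace ℝ (Fin d) :=
  ∫ ξ, wave n b ξ • u ξ

lemma coeff_apply {d : ℕ} (n : Fin d → ℤ) (b : ℝ) (u : L2Field d) (i : Fin d) :
    coeff n b u i = ∫ ξ, wave n b ξ * u ξ i :=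
  ((EuclideanSpace.proj (𝕜 := ℝ) i).integral_comp_comm
    (integrable_smul_field (isTest_wave n b).continuous u)).symm

lemma coeff_sub {d : ℕ} (n : Fin d → ℤ) (b : ℝ) (u v : L2Field d) :
    coeff n b (u - v) = coeff n b u - coeff n b v := by
  have hc := (isTest_wave n b).continuous
  rw [coeff, coeff, coeff, ← integral_sub (integrable_smul_field hc u) (integrable_smul_field hc v)]
  refine integral_congr_ae ?_
  filter_upwards [Lp.coeFn_sub u v] with ξ hξ
  rw [hξ, Pi.sub_apply, smul_sub]

lemma coeff_add {d : ℕ} (n : Fin d → ℤ) (b : ℝ) (u v : L2Field d) :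
    coeff n b (u + v) = coeff n b u + coeff n b v := by
  have hc := (isTest_wave n b).continuous
  rw [coeff, coeff, coeff, ← integral_add (integrable_smul_field hc u) (integrable_smul_field hc v)]
  refine integral_congr_ae ?_
  filter_upwards [Lp.coeFn_add u v] with ξ hξ
  rw [hξ, Pi.add_apply, smul_add]

lemma coeff_smul {d : ℕ} (n : Fin d → ℤ) (b c : ℝ) (u : L2Field d) :
    coeff n b (c • u) = c • coeff n b u := by
  rw [coeff, coeff, ← integral_smul]
  refine integral_congr_ae ?_
  filter_upwards [Lp.coeFn_smul c u] with ξ hξ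
  rw [hξ, Pi.smul_apply, smul_comm]

lemma coeff_add_pi {d : ℕ} (n : Fin d → ℤ) (b : ℝ) (u : L2Field d) :
    coeff n (b + Real.pi) u = - coeff n b u := by
  simp only [coeff, wave_add_pi, neg_smul, integral_neg]

/-- The squared size of the `n`-th Fourier mode of `u`. -/
def modeSq {d : ℕ} (n : Fin d → ℤ) (u : L2Field d) : ℝ :=
  ‖coeff n 0 u‖ ^ 2 + ‖coeff n (Real.pi / 2) u‖ ^ 2

lemma modeSq_nonneg {d : ℕ} (n : Fin d → ℤ) (u : L2Field d) : 0 ≤ modeSq n u := by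
  unfold modeSq; positivity

lemma norm_sq_eq_integral {d : ℕ} (u : L2Field d) :
    ‖u‖ ^ 2 = ∑ i, ∫ ξ, (u ξ i) ^ 2 := by
  have hi : ∀ i, Integrable (fun ξ => (u ξ i) ^ 2) volume := fun i =>
    (((EuclideanSpace.proj (𝕜 := ℝ) i).comp_memLp' (Lp.memLp u))).integrable_sq
  rw [← real_inner_self_eq_norm_sq, L2.inner_def, ← integral_finsetSum _ fun i _ => hi i]
  refine integral_congr_ae (Eventually.of_forall fun ξ => ?_)
  simp only [real_inner_self_eq_norm_sq, EuclideanSpace.real_norm_sq_eq]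

/-- Parseval's identity for vector fields. -/
lemma hasSum_modeSq {d : ℕ} (u : L2Field d) :
    HasSum (fun n => modeSq n u) ((2 * Real.pi) ^ d * ‖u‖ ^ 2) := by
  have h := hasSum_sum (s := Finset.univ) fun (i : Fin d) _ =>
    hasSum_wave_coeff ((EuclideanSpace.proj (𝕜 := ℝ) i).comp_memLp' (Lp.memLp u))
  rw [norm_sq_eq_integral, Finset.mul_sum]
  have hm : (fun n => modeSq n u) = fun n => ∑ i, ((∫ ξ, wave n 0 ξ * u ξ i) ^ 2
      + (∫ ξ, wave n (Real.pi / 2) ξ * u ξ i) ^ 2) := by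
    funext n
    simp only [modeSq, EuclideanSpace.real_norm_sq_eq, coeff_apply, ← Finset.sum_add_distrib]
  rw [hm]
  exact h

/-- A vector field is determined by its Fourier coefficients. -/
lemma eq_of_coeff_eq {d : ℕ} {u v : L2Field d} (h : ∀ n b, coeff n b u = coeff n b v) :
    u = v := by
  have h1 := hasSum_modeSq (u - v)
  have h2 : (fun n => modeSq n (u - v)) = fun _ => 0 := by
    funext n
    simp [modeSq, coeff_sub, h]
  rw [h2] at h1
  have h3 := h1.unique hasSum_zero
  have hp : (0 : ℝ) < (2 * Real.pi) ^ d := by positivity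
  have h4 : ‖u - v‖ = 0 := by
    rcases mul_eq_zero.1 h3 with h | h
    · exact absurd h hp.ne'
    · exact pow_eq_zero_iff (two_ne_zero) |>.1 h
  exact sub_eq_zero.1 (norm_eq_zero.1 h4)

/-! ### Weak derivatives and the Stokes operator in Fourier variables -/

/-- `|n|²` for a frequency `n`; it is the eigenvalue of `-Δ` on the plane waves of frequency `n`. -/
def freqSq {d : ℕ} (n : Fin d → ℤ) : ℝ := ∑ i, (n i : ℝ) ^ 2

lemma freqSq_pos {d : ℕ} {n : Fin d → ℤ} (hn : n ≠ 0) : 0 < freqSq n := by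
  obtain ⟨i, hi⟩ := Function.ne_iff.1 hn
  refine Finset.sum_pos' (fun _ _ => sq_nonneg _) ⟨i, Finset.mem_univ i, ?_⟩
  have : (n i : ℝ) ≠ 0 := by exact_mod_cast hi
  positivity

lemma one_le_freqSq {d : ℕ} {n : Fin d → ℤ} (hn : n ≠ 0) : 1 ≤ freqSq n := by
  have h : freqSq n = ((∑ i, (n i) ^ 2 : ℤ) : ℝ) := by simp [freqSq]
  have h1 := freqSq_pos hn
  rw [h] at h1 ⊢
  have h2 : 0 < ∑ i, (n i) ^ 2 := by exact_mod_cast h1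
  exact_mod_cast h2

lemma HasWeakDeriv.coeff_eq {d : ℕ} {i : Fin d} {u g : L2Field d} (h : HasWeakDeriv i u g)
    (n : Fin d → ℤ) (b : ℝ) :
    coeff n b g = -((n i : ℝ) • coeff n (b + Real.pi / 2) u) := by
  have h1 := h (wave n b) (isTest_wave n b)
  simp only [pderiv_wave, mul_smul, integral_smul] at h1
  rw [coeff, coeff, h1, neg_neg]

lemma HasWeakDeriv.sub {d : ℕ} {i : Fin d} {u g v k : L2Field d} (hu : HasWeakDeriv i u g)
    (hv : HasWeakDeriv i v k) : HasWeakDeriv i (u - v) (g - k) := by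
  intro φ hφ
  have hsub : ∀ {f : Torus d → ℝ} (_ : Continuous f) (p q : L2Field d),
      ∫ ξ, f ξ • (p - q : L2Field d) ξ = (∫ ξ, f ξ • p ξ) - ∫ ξ, f ξ • q ξ := by
    intro f hf p q
    rw [← integral_sub (integrable_smul_field hf p) (integrable_smul_field hf q)]
    refine integral_congr_ae ?_
    filter_upwards [Lp.coeFn_sub p q] with ξ hξ
    rw [hξ, Pi.sub_apply, smul_sub]
  rw [hsub (hφ.continuous_pderiv i), hsub hφ.continuous, hu φ hφ, hv φ hφ]
  abel

lemma HasWeakDeriv.unique {d : ℕ} {i : Fin d} {u g k : L2Field d} (hg : HasWeakDeriv i u g)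
    (hk : HasWeakDeriv i u k) : g = k :=
  eq_of_coeff_eq fun n b => by rw [hg.coeff_eq, hk.coeff_eq]

lemma HasWeakDeriv.weakDeriv_eq {d : ℕ} {i : Fin d} {u g : L2Field d}
    (h : HasWeakDeriv i u g) : weakDeriv i u = g := by
  have hex : ∃ g, HasWeakDeriv i u g := ⟨g, h⟩
  rw [weakDeriv, dif_pos hex]
  exact hex.choose_spec.unique h

lemma HasWeakDeriv.modeSq_eq {d : ℕ} {i : Fin d} {u g : L2Field d} (h : HasWeakDeriv i u g)
    (n : Fin d → ℤ) : modeSq n g = (n i : ℝ) ^ 2 * modeSq n u := by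
  have h1 : coeff n (Real.pi / 2 + Real.pi / 2) u = - coeff n 0 u := by
    rw [← coeff_add_pi]
    congr 1
    ring
  rw [modeSq, modeSq, h.coeff_eq, h.coeff_eq, h1, zero_add]
  simp only [norm_neg, smul_neg, norm_smul, mul_pow, Real.norm_eq_abs, sq_abs]
  ring

lemma IsStokes.coeff_eq {d : ℕ} {u f : H d} (h : IsStokes u f) (n : Fin d → ℤ) (b : ℝ) :
    coeff n b (f : L2Field d) = freqSq n • coeff n b (u : L2Field d) := by
  obtain ⟨g, k, hg, hk, hf⟩ := h
  have hadd : ∀ s : Finset (Fin d), coeff n b (∑ i ∈ s, k i i) = ∑ i ∈ s, coeff n b (k i i) := by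
    intro s
    induction s using Finset.induction_on with
    | empty => simpa using coeff_smul n b 0 (0 : L2Field d)
    | insert i s hi ih => rw [Finset.sum_insert hi, Finset.sum_insert hi, coeff_add, ih]
  have h1 : ∀ i, coeff n b (k i i) = -((n i : ℝ) ^ 2 • coeff n b (u : L2Field d)) := by
    intro i
    rw [(hk i i).coeff_eq, (hg i).coeff_eq,
      show b + Real.pi / 2 + Real.pi / 2 = b + Real.pi by ring,
      coeff_add_pi]
    module
  rw [hf, ← neg_one_smul ℝ, coeff_smul, hadd]
  simp only [h1, freqSq, Finset.sum_smul, Finset.sum_neg_distrib]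
  simp

lemma IsStokes.sub {d : ℕ} {u f v k : H d} (hu : IsStokes u f) (hv : IsStokes v k) :
    IsStokes (u - v) (f - k) := by
  obtain ⟨g, h, hg, hh, hf⟩ := hu
  obtain ⟨g', h', hg', hh', hf'⟩ := hv
  refine ⟨g - g', h - h', fun i => (hg i).sub (hg' i), fun i j => (hh i j).sub (hh' i j), ?_⟩
  rw [Submodule.coe_sub, hf, hf']
  simp only [Pi.sub_apply, Finset.sum_sub_distrib]
  abel

lemma IsStokes.hasWeakDeriv {d : ℕ} {u f : H d} (h : IsStokes u f) (i : Fin d) :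
    HasWeakDeriv i (u : L2Field d) (weakDeriv i (u : L2Field d)) := by
  obtain ⟨g, k, hg, -, -⟩ := h
  rw [(hg i).weakDeriv_eq]
  exact hg i

lemma IsStokes.weakDeriv_sub {d : ℕ} {u f v k : H d} (hu : IsStokes u f) (hv : IsStokes v k)
    (i : Fin d) : weakDeriv i ((u - v : H d) : L2Field d)
      = weakDeriv i (u : L2Field d) - weakDeriv i (v : L2Field d) := by
  rw [Submodule.coe_sub]
  exact ((hu.hasWeakDeriv i).sub (hv.hasWeakDeriv i)).weakDeriv_eq

lemma coeff_zero_freq {d : ℕ} (u : H d) (b : ℝ) : coeff 0 b (u : L2Field d) = 0 := by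
  rw [coeff]
  simp only [wave_zero]
  rw [integral_smul, u.2.1, smul_zero]

/-- The Fourier coefficients of a divergence free field are orthogonal to the frequency. -/
lemma sum_freq_mul_coeff {d : ℕ} (u : H d) (n : Fin d → ℤ) (b : ℝ) :
    ∑ i, (n i : ℝ) * coeff n b (u : L2Field d) i = 0 := by
  have h := u.2.2 (wave n (b - Real.pi / 2)) (isTest_wave n _)
  simp only [pderiv_wave, sub_add_cancel, mul_assoc] at h
  rw [integral_finsetSum] at h
  · simpa only [integral_const_mul, coeff_apply] using h
  · intro i _
    exact (integrable_mul_coord (isTest_wave n b).continuous (u : L2Field d) i).const_mul _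

lemma IsStokes.norm_le {d : ℕ} {u f : H d} (h : IsStokes u f) : ‖u‖ ≤ ‖f‖ := by
  have hp : (0 : ℝ) < (2 * Real.pi) ^ d := by positivity
  have h1 : (2 * Real.pi) ^ d * ‖(u : L2Field d)‖ ^ 2
      ≤ (2 * Real.pi) ^ d * ‖(f : L2Field d)‖ ^ 2 := by
    refine hasSum_le (fun n => ?_) (hasSum_modeSq _) (hasSum_modeSq _)
    by_cases hn : n = 0
    · subst hn; simp [modeSq, coeff_zero_freq]
    · have h2 := one_le_freqSq hn
      simp only [modeSq, h.coeff_eq, norm_smul, mul_pow, Real.norm_eq_abs, sq_abs]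
      rw [← mul_add]
      exact le_mul_of_one_le_left (by positivity) (one_le_pow₀ h2)
  exact (sq_le_sq₀ (norm_nonneg _) (norm_nonneg _)).1 (le_of_mul_le_mul_left h1 hp)

lemma IsStokes.norm_weakDeriv_le {d : ℕ} {u f : H d} (h : IsStokes u f) (i : Fin d) :
    ‖weakDeriv i (u : L2Field d)‖ ≤ ‖f‖ := by
  have hp : (0 : ℝ) < (2 * Real.pi) ^ d := by positivity
  have h1 : (2 * Real.pi) ^ d * ‖weakDeriv i (u : L2Field d)‖ ^ 2
      ≤ (2 * Real.pi) ^ d * ‖(f : L2Field d)‖ ^ 2 := by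
    refine hasSum_le (fun n => ?_) (hasSum_modeSq _) (hasSum_modeSq _)
    rw [(h.hasWeakDeriv i).modeSq_eq]
    by_cases hn : n = 0
    · subst hn; simp [modeSq, coeff_zero_freq]
    · have h2 := one_le_freqSq hn
      have h3 : (n i : ℝ) ^ 2 ≤ freqSq n :=
        Finset.single_le_sum (f := fun i => (n i : ℝ) ^ 2) (fun _ _ => sq_nonneg _)
          (Finset.mem_univ i)
      simp only [modeSq, h.coeff_eq, norm_smul, mul_pow, Real.norm_eq_abs, sq_abs]
      rw [← mul_add]
      refine mul_le_mul_of_nonneg_right ?_ (by positivity)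
      nlinarith
  exact (sq_le_sq₀ (norm_nonneg _) (norm_nonneg _)).1 (le_of_mul_le_mul_left h1 hp)

/-- The squared `L²` norm of the gradient of `u`. -/
def gradSq {d : ℕ} (u : H d) : ℝ := ∑ i, ‖weakDeriv i (u : L2Field d)‖ ^ 2

/-- Parseval's identity for the gradient. -/
lemma IsStokes.hasSum_gradSq {d : ℕ} {u f : H d} (h : IsStokes u f) :
    HasSum (fun n => freqSq n * modeSq n (u : L2Field d)) ((2 * Real.pi) ^ d * gradSq u) := by
  have h1 := hasSum_sum (s := Finset.univ) fun (i : Fin d) _ =>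
    hasSum_modeSq (weakDeriv i (u : L2Field d))
  simp only [(h.hasWeakDeriv _).modeSq_eq, ← Finset.sum_mul, ← Finset.mul_sum] at h1
  exact h1

/-- Poincaré's inequality for mean zero fields. -/
lemma IsStokes.norm_sq_le_gradSq {d : ℕ} {u f : H d} (h : IsStokes u f) :
    ‖u‖ ^ 2 ≤ gradSq u := by
  have hp : (0 : ℝ) < (2 * Real.pi) ^ d := by positivity
  have h1 : (2 * Real.pi) ^ d * ‖(u : L2Field d)‖ ^ 2 ≤ (2 * Real.pi) ^ d * gradSq u := by
    refine hasSum_le (fun n => ?_) (hasSum_modeSq _) h.hasSum_gradSq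
    by_cases hn : n = 0
    · subst hn; simp [modeSq, coeff_zero_freq]
    · exact le_mul_of_one_le_left (modeSq_nonneg _ _) (one_le_freqSq hn)
  exact le_of_mul_le_mul_left h1 hp

/-! ### Divergence free plane waves as test fields -/

/-- The derivative of a test function along the line of direction `a`. -/
lemma IsTest.hasDerivAt_line {d : ℕ} {φ : Torus d → ℝ} (hφ : IsTest φ) (a : Fin d → ℝ)
    (ξ : Torus d) (t : ℝ) :
    HasDerivAt (fun s : ℝ => φ (ξ + proj d (s • a)))
      (∑ i, a i * pderiv i φ (ξ + proj d (t • a))) t := by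
  obtain ⟨x, rfl⟩ := proj_surjective d ξ
  simp only [← proj_add]
  have hd := (ContDiff.differentiable hφ (by simp)) (x + t • a)
  have hl : HasDerivAt (fun s : ℝ => x + s • a) a t := by
    simpa using ((hasDerivAt_id t).smul_const a).const_add x
  have h := hd.hasFDerivAt.comp_hasDerivAt t hl
  have he : ∑ i, a i * pderiv i φ (proj d (x + t • a))
      = fderiv ℝ (fun y => φ (proj d y)) (x + t • a) a := by
    simp only [hφ.pderiv_proj]
    generalize fderiv ℝ (fun y => φ (proj d y)) (x + t • a) = D
    conv_rhs => rw [← Finset.univ_sum_single a]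
    rw [map_sum]
    refine Finset.sum_congr rfl fun i _ => ?_
    rw [← smul_eq_mul, ← map_smul, ← Pi.single_smul, smul_eq_mul, mul_one]
  rw [he]
  exact h

/-- Divergence freeness of the field `cos (n · ξ + b) a` for `a` orthogonal to `n`. -/
lemma IsTest.integral_deriv_mul_wave {d : ℕ} {φ : Torus d → ℝ} (hφ : IsTest φ) (n : Fin d → ℤ)
    (b : ℝ) (a : Fin d → ℝ) (ha : ∑ i, n i * a i = 0) :
    ∫ ξ, (∑ i, a i * pderiv i φ ξ) * wave n b ξ = 0 := by
  -- The wave is constant along `a`, so by translation invariance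
  -- `t ↦ ∫ φ (ξ + t a) wave (ξ) dξ` is constant; its derivative at `0` is the integral here.
  have hconst : ∀ t : ℝ, ∫ ξ, φ (ξ + proj d (t • a)) * wave n b ξ = ∫ ξ, φ ξ * wave n b ξ := by
    intro t
    rw [← integral_add_right_eq_self (fun ξ => φ ξ * wave n b ξ) (proj d (t • a))]
    refine integral_congr_ae (Eventually.of_forall fun ξ => ?_)
    have h0 : ∑ i, (n i : ℝ) * (t • a) i = 0 := by
      simp only [Pi.smul_apply, smul_eq_mul, mul_left_comm _ t, ← Finset.mul_sum, ha, mul_zero]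
    simp only [wave_add_proj, h0, add_zero]
  have hcD : Continuous fun ξ => ∑ i, a i * pderiv i φ ξ :=
    continuous_finsetSum _ fun i _ => continuous_const.mul (hφ.continuous_pderiv i)
  have hcw := (isTest_wave n b).continuous
  obtain ⟨C, hC⟩ := isCompact_univ.exists_bound_of_continuousOn hcD.continuousOn
  have hint : ∀ {f : Torus d → ℝ}, Continuous f → Integrable f volume := fun hf =>
    hf.integrable_of_hasCompactSupport (HasCompactSupport.of_compactSpace _)
  have h := (hasDerivAt_integral_of_dominated_loc_of_deriv_le (μ := (volume : Measure (Torus d)))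
    (F := fun t ξ => φ (ξ + proj d (t • a)) * wave n b ξ)
    (F' := fun t ξ => (∑ i, a i * pderiv i φ (ξ + proj d (t • a))) * wave n b ξ)
    (x₀ := (0 : ℝ)) (bound := fun _ => C) (s := Set.univ) univ_mem
    (Eventually.of_forall fun t => ((hφ.continuous.comp
      (continuous_add_const _)).mul hcw).aestronglyMeasurable)
    (hint ((hφ.continuous.comp (continuous_add_const _)).mul hcw))
    ((hcD.comp (continuous_add_const _)).mul hcw).aestronglyMeasurable
    (Eventually.of_forall fun ξ t _ => by
      rw [norm_mul]
      have h1 := hC (ξ + proj d (t • a)) (Set.mem_univ _)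
      have h2 : ‖wave n b ξ‖ ≤ 1 := abs_wave_le n b ξ
      exact (mul_le_of_le_one_right (norm_nonneg _) h2).trans h1)
    (integrable_const C)
    (Eventually.of_forall fun ξ t _ => (hφ.hasDerivAt_line a ξ t).mul_const _)).2
  simp only [hconst] at h
  have h2 := h.unique (hasDerivAt_const _ _)
  have h3 : proj d ((0 : ℝ) • a) = 0 := by funext i; simp [proj]
  simpa only [h3, add_zero] using h2

lemma integral_wave {d : ℕ} {n : Fin d → ℤ} (hn : n ≠ 0) (b : ℝ) : ∫ ξ, wave n b ξ = 0 := by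
  -- Translation by `π n / |n|²` changes the sign of the wave.
  have h := integral_add_right_eq_self (μ := (volume : Measure (Torus d))) (wave n b)
    (proj d fun i => Real.pi / freqSq n * n i)
  have h1 : ∑ i, (n i : ℝ) * (Real.pi / freqSq n * n i) = Real.pi := by
    have : ∀ i, (n i : ℝ) * (Real.pi / freqSq n * n i) = Real.pi / freqSq n * (n i : ℝ) ^ 2 := by
      intro i; ring
    simp only [this, ← Finset.mul_sum]
    exact div_mul_cancel₀ _ (freqSq_pos hn).ne'
  simp only [wave_add_proj, h1, wave_add_pi, integral_neg] at h
  linarith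

lemma memLp_waveField {d : ℕ} (n : Fin d → ℤ) (b : ℝ) (a : EuclideanSpace ℝ (Fin d)) :
    MemLp (fun ξ => wave n b ξ • a) 2 (volume : Measure (Torus d)) :=
  MemLp.of_bound ((isTest_wave n b).continuous.smul continuous_const).aestronglyMeasurable ‖a‖
    (Eventually.of_forall fun ξ => by
      rw [norm_smul]
      exact mul_le_of_le_one_left (norm_nonneg _) (abs_wave_le n b ξ))

/-- The plane wave field `ξ ↦ cos (n · ξ + b) a`. -/
def waveField {d : ℕ} (n : Fin d → ℤ) (b : ℝ) (a : EuclideanSpace ℝ (Fin d)) : L2Field d :=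
  (memLp_waveField n b a).toLp _

lemma coeFn_waveField {d : ℕ} (n : Fin d → ℤ) (b : ℝ) (a : EuclideanSpace ℝ (Fin d)) :
    waveField n b a =ᵐ[volume] fun ξ => wave n b ξ • a :=
  (memLp_waveField n b a).coeFn_toLp

lemma waveField_mem_H {d : ℕ} {n : Fin d → ℤ} (hn : n ≠ 0) (b : ℝ)
    {a : EuclideanSpace ℝ (Fin d)} (ha : ∑ i, n i * a i = 0) : waveField n b a ∈ H d := by
  refine ⟨?_, fun φ hφ => ?_⟩
  · rw [integral_congr_ae (coeFn_waveField n b a), integral_smul_const, integral_wave hn, zero_smul]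
  · rw [← hφ.integral_deriv_mul_wave n b a ha]
    refine integral_congr_ae ?_
    filter_upwards [coeFn_waveField n b a] with ξ hξ
    rw [hξ, Finset.sum_mul]
    refine Finset.sum_congr rfl fun i _ => ?_
    simp
    ring

lemma inner_waveField {d : ℕ} (n : Fin d → ℤ) (b : ℝ) (a : EuclideanSpace ℝ (Fin d))
    (u : L2Field d) : ⟪u, waveField n b a⟫_ℝ = ⟪coeff n b u, a⟫_ℝ := by
  rw [L2.inner_def, real_inner_comm, coeff,
    ← integral_inner (integrable_smul_field (isTest_wave n b).continuous u)]
  refine integral_congr_ae ?_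
  filter_upwards [coeFn_waveField n b a] with ξ hξ
  rw [hξ, real_inner_smul_right, real_inner_smul_right, real_inner_comm]

/-- The orthogonal projection onto `n^⊥` of the `j`-th vector of the standard basis. -/
def transverse {d : ℕ} (n : Fin d → ℤ) (j : Fin d) : EuclideanSpace ℝ (Fin d) :=
  EuclideanSpace.single j 1 - ((n j : ℝ) / freqSq n) • WithLp.toLp 2 fun i => (n i : ℝ)

lemma inner_transverse {d : ℕ} (n : Fin d → ℤ) (j : Fin d) (c : EuclideanSpace ℝ (Fin d)) :
    ⟪c, transverse n j⟫_ℝ = c j - (n j : ℝ) / freqSq n * ∑ i, n i * c i := by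
  rw [transverse, inner_sub_right, real_inner_smul_right]
  simp [PiLp.inner_apply]

lemma sum_freq_mul_transverse {d : ℕ} {n : Fin d → ℤ} (hn : n ≠ 0) (j : Fin d) :
    ∑ i, n i * transverse n j i = 0 := by
  have h := inner_transverse n j (WithLp.toLp 2 fun i => (n i : ℝ))
  have h2 : ⟪(WithLp.toLp 2 fun i => (n i : ℝ) : EuclideanSpace ℝ (Fin d)), transverse n j⟫_ℝ
      = ∑ i, n i * transverse n j i := by
    simp [PiLp.inner_apply, mul_comm]
  rw [← h2, h]
  have h3 : ∑ i, (n i : ℝ) * (n i : ℝ) = freqSq n := by simp [freqSq, sq]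
  simp only [h3]
  rw [div_mul_cancel₀ _ (freqSq_pos hn).ne', sub_self]

lemma norm_transverse_le {d : ℕ} {n : Fin d → ℤ} (hn : n ≠ 0) (j : Fin d) :
    ‖transverse n j‖ ≤ 1 := by
  -- A projection satisfies `‖p‖² = ⟪p, e⟫ = p j ≤ ‖p‖`.
  have h := inner_transverse n j (transverse n j)
  rw [sum_freq_mul_transverse hn, mul_zero, sub_zero, real_inner_self_eq_norm_sq] at h
  have h2 : transverse n j j ≤ ‖transverse n j‖ :=
    (le_abs_self _).trans (PiLp.norm_apply_le (transverse n j) j)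
  nlinarith [norm_nonneg (transverse n j)]

/-- The divergence free test field which reads off the `j`-th component of the Fourier
coefficient `coeff n b u` of a divergence free field `u`. -/
def testField {d : ℕ} {n : Fin d → ℤ} (hn : n ≠ 0) (b : ℝ) (j : Fin d) : H d :=
  ⟨waveField n b (transverse n j), waveField_mem_H hn b (sum_freq_mul_transverse hn j)⟩

lemma inner_testField {d : ℕ} {n : Fin d → ℤ} (hn : n ≠ 0) (b : ℝ) (j : Fin d) (u : H d) :
    ⟪u, testField hn b j⟫_ℝ = coeff n b (u : L2Field d) j := by
  rw [Submodule.coe_inner, testField, inner_waveField, inner_transverse, sum_freq_mul_coeff,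
    mul_zero, sub_zero]

lemma norm_testField_le {d : ℕ} {n : Fin d → ℤ} (hn : n ≠ 0) (b : ℝ) (j : Fin d) :
    ∀ᵐ ξ, ‖(testField hn b j : L2Field d) ξ‖ ≤ 1 := by
  filter_upwards [coeFn_waveField n b (transverse n j)] with ξ hξ
  rw [testField, hξ, norm_smul]
  exact mul_le_one₀ (abs_wave_le n b ξ) (norm_nonneg _) (norm_transverse_le hn j)

/-- The test fields are eigenvectors of every power of the Stokes operator. -/
lemma isStokesPow_testField {d : ℕ} {n : Fin d → ℤ} (hn : n ≠ 0) (b : ℝ) (j : Fin d) (s : ℝ) :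
    IsStokesPow s (testField hn b j) (freqSq n ^ s • testField hn b j) := by
  intro l e he
  have h := congrArg (fun c : EuclideanSpace ℝ (Fin d) => c j) (he.coeff_eq n b)
  simp only [Submodule.coe_smul, coeff_smul, PiLp.smul_apply, smul_eq_mul] at h
  rw [Submodule.coe_inner, Submodule.coe_smul, real_inner_smul_left, ← Submodule.coe_inner,
    real_inner_comm, inner_testField]
  rcases eq_or_ne (coeff n b (e : L2Field d) j) 0 with h0 | h0
  · rw [h0, mul_zero, mul_zero]
  · rw [mul_right_cancel₀ h0 h]

/-! ### The bilinear operator -/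

lemma memLp_coord_smul {d : ℕ} {φ : L2Field d} (hφ : ∀ᵐ ξ, ‖φ ξ‖ ≤ 1) (i : Fin d)
    (u : L2Field d) : MemLp (fun ξ => u ξ i • φ ξ) 2 volume := by
  refine (Lp.memLp u).mono ?_ ?_
  · exact ((EuclideanSpace.proj (𝕜 := ℝ) i).continuous.comp_aestronglyMeasurable
      (Lp.aestronglyMeasurable u)).smul (Lp.aestronglyMeasurable φ)
  · filter_upwards [hφ] with ξ hξ
    rw [norm_smul]
    exact (mul_le_of_le_one_right (norm_nonneg _) hξ).trans (PiLp.norm_apply_le (u ξ) i)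

/-- The map `u ↦ u_i φ` on square integrable fields, for a field `φ` bounded by `1`. -/
def coordSmul {d : ℕ} {φ : L2Field d} (hφ : ∀ᵐ ξ, ‖φ ξ‖ ≤ 1) (i : Fin d) :
    L2Field d →L[ℝ] L2Field d :=
  LinearMap.mkContinuous
    { toFun := fun u => (memLp_coord_smul hφ i u).toLp _
      map_add' := fun u v => by
        rw [← MemLp.toLp_add, MemLp.toLp_eq_toLp_iff]
        filter_upwards [Lp.coeFn_add u v] with ξ hξ
        rw [hξ]
        simp [add_smul]
      map_smul' := fun c u => by
        rw [RingHom.id_apply, ← MemLp.toLp_const_smul, MemLp.toLp_eq_toLp_iff]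
        filter_upwards [Lp.coeFn_smul c u] with ξ hξ
        rw [hξ]
        simp [mul_smul] } 1 fun u => by
    rw [one_mul]
    refine Lp.norm_le_norm_of_ae_le ?_
    filter_upwards [hφ, (memLp_coord_smul hφ i u).coeFn_toLp] with ξ hξ h2
    simp only [LinearMap.coe_mk, AddHom.coe_mk, h2, norm_smul]
    exact (mul_le_of_le_one_right (norm_nonneg _) hξ).trans (PiLp.norm_apply_le (u ξ) i)

lemma coeFn_coordSmul {d : ℕ} {φ : L2Field d} (hφ : ∀ᵐ ξ, ‖φ ξ‖ ≤ 1) (i : Fin d)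
    (u : L2Field d) : coordSmul hφ i u =ᵐ[volume] fun ξ => u ξ i • φ ξ :=
  (memLp_coord_smul hφ i u).coeFn_toLp

lemma norm_coordSmul_le {d : ℕ} {φ : L2Field d} (hφ : ∀ᵐ ξ, ‖φ ξ‖ ≤ 1) (i : Fin d)
    (u : L2Field d) : ‖coordSmul hφ i u‖ ≤ ‖u‖ := by
  refine Lp.norm_le_norm_of_ae_le ?_
  filter_upwards [hφ, coeFn_coordSmul hφ i u] with ξ hξ h2
  rw [h2, norm_smul]
  exact (mul_le_of_le_one_right (norm_nonneg _) hξ).trans (PiLp.norm_apply_le (u ξ) i)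

lemma bform_eq_sum_inner {d : ℕ} {z : H d} (hz : ∀ᵐ ξ, ‖(z : L2Field d) ξ‖ ≤ 1) (u v : H d) :
    bform u v z = ∑ i, ⟪weakDeriv i (v : L2Field d), coordSmul hz i (u : L2Field d)⟫_ℝ := by
  simp only [L2.inner_def]
  rw [bform, ← integral_finsetSum _ fun i _ => L2.integrable_inner _ _]
  refine integral_congr_ae ?_
  have h : ∀ᵐ ξ, ∀ i, coordSmul hz i (u : L2Field d) ξ
      = (u : L2Field d) ξ i • (z : L2Field d) ξ :=
    ae_all_iff.2 fun i => coeFn_coordSmul hz i _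
  filter_upwards [h] with ξ hξ
  simp only [hξ, real_inner_smul_right]

lemma abs_inner_coordSmul_le {d : ℕ} {φ : L2Field d} (hφ : ∀ᵐ ξ, ‖φ ξ‖ ≤ 1) (i : Fin d)
    (g u : L2Field d) : |⟪g, coordSmul hφ i u⟫_ℝ| ≤ ‖g‖ * ‖u‖ :=
  (abs_real_inner_le_norm _ _).trans
    (mul_le_mul_of_nonneg_left (norm_coordSmul_le hφ i u) (norm_nonneg _))

lemma gradSq_nonneg {d : ℕ} (u : H d) : 0 ≤ gradSq u :=
  Finset.sum_nonneg fun _ _ => sq_nonneg _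

/-- The increments of `u ↦ ⟨B(u,u), z⟩` are controlled by the gradient of the increment of `u`. -/
lemma sq_bform_sub_bform_le {d : ℕ} {z : H d} (hz : ∀ᵐ ξ, ‖(z : L2Field d) ξ‖ ≤ 1)
    {u f v k : H d} (hu : IsStokes u f) (hv : IsStokes v k) {M : ℝ} (hf : ‖f‖ ≤ M)
    (hk : ‖k‖ ≤ M) :
    (bform u u z - bform v v z) ^ 2 ≤ (2 * d * M) ^ 2 * gradSq (u - v) := by
  have hM : 0 ≤ M := (norm_nonneg _).trans hf
  have hsub := hu.sub hv
  set G := gradSq (u - v)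
  have hG : 0 ≤ G := gradSq_nonneg _
  have hdiff : bform u u z - bform v v z
      = ∑ i, (⟪weakDeriv i (u : L2Field d), coordSmul hz i ((u - v : H d) : L2Field d)⟫_ℝ
        + ⟪weakDeriv i ((u - v : H d) : L2Field d), coordSmul hz i (v : L2Field d)⟫_ℝ) := by
    rw [bform_eq_sum_inner hz, bform_eq_sum_inner hz, ← Finset.sum_sub_distrib]
    refine Finset.sum_congr rfl fun i _ => ?_
    rw [hu.weakDeriv_sub hv, Submodule.coe_sub, map_sub, inner_sub_right, inner_sub_left]
    ring
  have hn : ‖u - v‖ ≤ Real.sqrt G := Real.le_sqrt_of_sq_le hsub.norm_sq_le_gradSq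
  have hg : ∀ i, ‖weakDeriv i ((u - v : H d) : L2Field d)‖ ≤ Real.sqrt G := fun i =>
    Real.le_sqrt_of_sq_le (Finset.single_le_sum
      (f := fun i => ‖weakDeriv i ((u - v : H d) : L2Field d)‖ ^ 2)
      (fun _ _ => sq_nonneg _) (Finset.mem_univ i))
  have hterm : ∀ i ∈ (Finset.univ : Finset (Fin d)),
      |⟪weakDeriv i (u : L2Field d), coordSmul hz i ((u - v : H d) : L2Field d)⟫_ℝ
        + ⟪weakDeriv i ((u - v : H d) : L2Field d), coordSmul hz i (v : L2Field d)⟫_ℝ|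
      ≤ 2 * M * Real.sqrt G := by
    intro i _
    refine (abs_add_le _ _).trans ?_
    have h1 := (abs_inner_coordSmul_le hz i (weakDeriv i (u : L2Field d))
      ((u - v : H d) : L2Field d)).trans (mul_le_mul ((hu.norm_weakDeriv_le i).trans hf) hn
        (norm_nonneg _) hM)
    have h2 := (abs_inner_coordSmul_le hz i (weakDeriv i ((u - v : H d) : L2Field d))
      (v : L2Field d)).trans (mul_le_mul (hg i) (hv.norm_le.trans hk)
        (norm_nonneg _) (Real.sqrt_nonneg _))
    linarith
  have habs : |bform u u z - bform v v z| ≤ 2 * d * M * Real.sqrt G := by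
    rw [hdiff]
    refine (Finset.abs_sum_le_sum_abs _ _).trans ((Finset.sum_le_sum hterm).trans (le_of_eq ?_))
    simp
    ring
  calc (bform u u z - bform v v z) ^ 2 = |bform u u z - bform v v z| ^ 2 := (sq_abs _).symm
    _ ≤ (2 * d * M * Real.sqrt G) ^ 2 := pow_le_pow_left₀ (abs_nonneg _) habs 2
    _ = (2 * d * M) ^ 2 * G := by rw [mul_pow, Real.sq_sqrt hG]

/-! ### Continuity along paths in the domain of the Stokes operator -/

/-- A map that is Lipschitz with respect to the graph of `A` is continuous along a path in
`C(ℝ; D(A))`. -/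
lemma continuous_of_norm_sub_le {E : Type*} [SeminormedAddCommGroup E] {d : ℕ} {f : ℝ → E}
    {Au : ℝ → H d} (hAu : Continuous Au) (h : ∀ s t, ‖f s - f t‖ ≤ ‖Au s - Au t‖) :
    Continuous f := by
  refine continuous_iff_continuousAt.2 fun t => ?_
  refine tendsto_iff_norm_sub_tendsto_zero.2 ?_
  refine squeeze_zero (fun _ => norm_nonneg _) (fun s => h s t) ?_
  exact tendsto_iff_norm_sub_tendsto_zero.1 hAu.continuousAt

lemma continuous_of_isStokes {d : ℕ} {u Au : ℝ → H d} (hu : ∀ t, IsStokes (u t) (Au t))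
    (hAu : Continuous Au) : Continuous u :=
  continuous_of_norm_sub_le hAu fun s t => ((hu s).sub (hu t)).norm_le

lemma continuous_weakDeriv {d : ℕ} {u Au : ℝ → H d} (hu : ∀ t, IsStokes (u t) (Au t))
    (hAu : Continuous Au) (i : Fin d) : Continuous fun t => weakDeriv i (u t : L2Field d) :=
  continuous_of_norm_sub_le hAu fun s t => by
    rw [← (hu s).weakDeriv_sub (hu t)]
    exact ((hu s).sub (hu t)).norm_weakDeriv_le i

lemma continuous_gradSq {d : ℕ} {u Au : ℝ → H d} (hu : ∀ t, IsStokes (u t) (Au t))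
    (hAu : Continuous Au) : Continuous fun t => gradSq (u t) :=
  continuous_finsetSum _ fun i _ => (continuous_weakDeriv hu hAu i).norm.pow 2

lemma continuous_bform {d : ℕ} {z : H d} (hz : ∀ᵐ ξ, ‖(z : L2Field d) ξ‖ ≤ 1)
    {u Au : ℝ → H d} (hu : ∀ t, IsStokes (u t) (Au t)) (hAu : Continuous Au) :
    Continuous fun t => bform (u t) (u t) z := by
  simp only [bform_eq_sum_inner hz]
  exact continuous_finsetSum _ fun i _ => (continuous_weakDeriv hu hAu i).inner
    ((coordSmul hz i).continuous.comp
      (continuous_subtype_val.comp (continuous_of_isStokes hu hAu)))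

/-! ### Scalar estimates -/

/-- The energy estimate for `y' = -κ y - N`, `y(0) = 0`: by Young's inequality
`(y²)' = -2 κ y² - 2 y N ≤ N² / (2 κ)`. -/
lemma sq_le_integral_sq {κ T : ℝ} (hκ : 0 < κ) {y N : ℝ → ℝ} (hy : Continuous y)
    (hN : Continuous N)
    (h : ∀ t ∈ Set.Icc 0 T, y t = -κ * (∫ s in (0 : ℝ)..t, y s) - ∫ s in (0 : ℝ)..t, N s)
    {t : ℝ} (ht : t ∈ Set.Icc 0 T) :
    y t ^ 2 ≤ (2 * κ)⁻¹ * ∫ s in (0 : ℝ)..t, N s ^ 2 := by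
  set Y : ℝ → ℝ := fun t => -κ * (∫ s in (0 : ℝ)..t, y s) - ∫ s in (0 : ℝ)..t, N s with hY
  have hYd : ∀ t, HasDerivAt Y (-κ * y t - N t) t := fun t =>
    ((hy.integral_hasStrictDerivAt 0 t).hasDerivAt.const_mul _).sub
      (hN.integral_hasStrictDerivAt 0 t).hasDerivAt
  set D : ℝ → ℝ := fun t => (2 * κ)⁻¹ * (∫ s in (0 : ℝ)..t, N s ^ 2) - Y t ^ 2 with hD
  have hDd : ∀ t, HasDerivAt D ((2 * κ)⁻¹ * N t ^ 2 - 2 * Y t * (-κ * y t - N t)) t := by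
    intro t
    have h1 := (((hN.pow 2).integral_hasStrictDerivAt 0 t).hasDerivAt.const_mul (2 * κ)⁻¹).sub
      ((hYd t).pow 2)
    refine h1.congr_deriv ?_
    simp
  have hmono : MonotoneOn D (Set.Icc 0 T) := by
    refine monotoneOn_of_deriv_nonneg (convex_Icc 0 T)
      (fun t _ => (hDd t).continuousAt.continuousWithinAt)
      (fun t _ => (hDd t).differentiableAt.differentiableWithinAt) fun t ht => ?_
    have hyt : y t = Y t := h t (interior_subset ht)
    rw [(hDd t).deriv, hyt]
    -- The derivative is a complete square.
    have : (2 * κ)⁻¹ * N t ^ 2 - 2 * Y t * (-κ * Y t - N t)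
        = (2 * κ)⁻¹ * (N t + 2 * κ * Y t) ^ 2 := by
      field_simp
      ring
    rw [this]
    positivity
  have h0 : D 0 = 0 := by simp [hD, hY]
  have h1 := hmono ⟨le_rfl, ht.1.trans ht.2⟩ ht ht.1
  rw [h0] at h1
  rw [h t ht]
  simp only [hD, hY] at h1
  linarith

/-- Grönwall's inequality without initial term. -/
lemma eq_zero_of_le_integral {C T : ℝ} {G : ℝ → ℝ} (hG : Continuous G) (hG0 : ∀ t, 0 ≤ G t)
    (h : ∀ t ∈ Set.Icc 0 T, G t ≤ C * ∫ s in (0 : ℝ)..t, G s) :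
    ∀ t ∈ Set.Icc 0 T, G t = 0 := by
  have hd : ∀ t, HasDerivAt (fun t => ∫ s in (0 : ℝ)..t, G s) (G t) t := fun t =>
    (hG.integral_hasStrictDerivAt 0 t).hasDerivAt
  have hI := eq_zero_of_abs_deriv_le_mul_abs_self_of_eq_zero_right (K := C) (a := 0) (b := T)
    (f := fun t => ∫ s in (0 : ℝ)..t, G s) (f' := G)
    (fun t _ => (hd t).continuousAt.continuousWithinAt)
    (fun t _ => (hd t).hasDerivWithinAt) (by simp) (fun t ht => by
      rw [Real.norm_of_nonneg (hG0 t), Real.norm_of_nonneg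
        (intervalIntegral.integral_nonneg ht.1 fun s _ => hG0 s)]
      exact h t ⟨ht.1, ht.2.le⟩)
  intro t ht
  refine le_antisymm ?_ (hG0 t)
  simpa [hI t ht] using h t ht

/-- Comparison with `∑ ‖n‖^(2r)` over the lattice `ℤ^d` in Euclidean space. With `r = 1 - α` the
condition is `α > d/2 + 1`. -/
lemma summable_freqSq_rpow {d : ℕ} {r : ℝ} (hr : r < -(d : ℝ) / 2) :
    Summable fun n : Fin d → ℤ => freqSq n ^ r := by
  let b := (EuclideanSpace.basisFun (Fin d) ℝ).toBasis
  let L := Submodule.span ℤ (Set.range b)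
  let bz : Module.Basis (Fin d) ℤ L := b.restrictScalars ℤ
  have hrank : Module.finrank ℤ L = d := by
    rw [Module.finrank_eq_card_basis bz, Fintype.card_fin]
  have hs := ZLattice.summable_norm_rpow L (2 * r) (by rw [hrank]; linarith)
  have hc := hs.comp_injective bz.equivFun.symm.injective
  refine hc.congr fun n => ?_
  have hcoe : ((bz.equivFun.symm n : L) : EuclideanSpace ℝ (Fin d))
      = WithLp.toLp 2 fun i => (n i : ℝ) := by
    have hbz : ∀ i, (bz i : EuclideanSpace ℝ (Fin d)) = EuclideanSpace.single i 1 := fun i => by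
      rw [Module.Basis.restrictScalars_apply]
      simp [b]
    rw [Module.Basis.equivFun_symm_apply, Submodule.coe_sum]
    ext j
    simp [hbz, Pi.single_apply]
  have hnorm : ‖(bz.equivFun.symm n : L)‖ ^ 2 = freqSq n := by
    rw [show ‖bz.equivFun.symm n‖
        = ‖((bz.equivFun.symm n : L) : EuclideanSpace ℝ (Fin d))‖ from rfl,
      hcoe, EuclideanSpace.real_norm_sq_eq, freqSq]
  rw [Function.comp_apply, ← hnorm, ← Real.rpow_natCast_mul (norm_nonneg _)]
  norm_num

/-! ### Uniqueness for a fixed path -/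

/-- Two paths in `C(ℝ; D(A))` whose difference satisfies on `[0,T]` the equations of all Fourier
modes, from which the noise has disappeared, coincide on `[0,T]`. -/
theorem eq_of_mode_equations {d : ℕ} {ν α T : ℝ} (hν : 0 < ν) (hα : (d : ℝ) / 2 + 1 < α)
    {u v Au Av : ℝ → H d} (hu : ∀ t, IsStokes (u t) (Au t)) (hAu : Continuous Au)
    (hv : ∀ t, IsStokes (v t) (Av t)) (hAv : Continuous Av)
    (heq : ∀ (n : Fin d → ℤ) (hn : n ≠ 0), ∀ b ∈ ({0, Real.pi / 2} : Set ℝ), ∀ j,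
      ∀ t ∈ Set.Icc 0 T, ⟪u t - v t, testField hn b j⟫_ℝ
        = -(ν * freqSq n ^ α) * (∫ s in (0 : ℝ)..t, ⟪u s - v s, testField hn b j⟫_ℝ)
          - ∫ s in (0 : ℝ)..t, (bform (u s) (u s) (testField hn b j)
            - bform (v s) (v s) (testField hn b j))) :
    ∀ t ∈ Set.Icc 0 T, u t = v t := by
  obtain ⟨M₁, hM₁⟩ := (isCompact_Icc (a := 0) (b := T)).exists_bound_of_continuousOn
    hAu.continuousOn
  obtain ⟨M₂, hM₂⟩ := (isCompact_Icc (a := 0) (b := T)).exists_bound_of_continuousOn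
    hAv.continuousOn
  set M := max M₁ M₂
  set L : ℝ := (2 * d * M) ^ 2 with hL
  have hL0 : 0 ≤ L := sq_nonneg _
  have hw : ∀ t, IsStokes (u t - v t) (Au t - Av t) := fun t => (hu t).sub (hv t)
  set G : ℝ → ℝ := fun t => gradSq (u t - v t) with hGdef
  have hG : Continuous G := continuous_gradSq hw (hAu.sub hAv)
  have hG0 : ∀ t, 0 ≤ G t := fun t => gradSq_nonneg _
  have hI0 : ∀ t ∈ Set.Icc 0 T, 0 ≤ ∫ s in (0 : ℝ)..t, G s := fun t ht =>
    intervalIntegral.integral_nonneg ht.1 fun s _ => hG0 s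
  have hcoeff : ∀ (n : Fin d → ℤ) (_ : n ≠ 0), ∀ b ∈ ({0, Real.pi / 2} : Set ℝ),
      ∀ t ∈ Set.Icc 0 T, ‖coeff n b ((u t - v t : H d) : L2Field d)‖ ^ 2
        ≤ d * ((2 * (ν * freqSq n ^ α))⁻¹ * (L * ∫ s in (0 : ℝ)..t, G s)) := by
    intro n hn b hb t ht
    have hκ : 0 < ν * freqSq n ^ α := mul_pos hν (Real.rpow_pos_of_pos (freqSq_pos hn) _)
    have hj : ∀ j ∈ (Finset.univ : Finset (Fin d)),
        (coeff n b ((u t - v t : H d) : L2Field d) j) ^ 2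
          ≤ (2 * (ν * freqSq n ^ α))⁻¹ * (L * ∫ s in (0 : ℝ)..t, G s) := by
      intro j _
      have hz := norm_testField_le hn b j
      have hN : Continuous fun s => bform (u s) (u s) (testField hn b j)
          - bform (v s) (v s) (testField hn b j) :=
        (continuous_bform hz hu hAu).sub (continuous_bform hz hv hAv)
      have h1 := sq_le_integral_sq hκ
        (((continuous_of_isStokes hu hAu).sub (continuous_of_isStokes hv hAv)).inner
          continuous_const) hN (heq n hn b hb j) ht
      rw [← inner_testField hn]
      refine h1.trans (mul_le_mul_of_nonneg_left ?_ (inv_nonneg.2 (by positivity)))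
      rw [← intervalIntegral.integral_const_mul]
      refine intervalIntegral.integral_mono_on ht.1 ((hN.pow 2).intervalIntegrable _ _)
        ((hG.const_mul L).intervalIntegrable _ _) fun s hs => ?_
      have hs' : s ∈ Set.Icc 0 T := ⟨hs.1, hs.2.trans ht.2⟩
      exact sq_bform_sub_bform_le hz (hu s) (hv s) ((hM₁ s hs').trans (le_max_left _ _))
        ((hM₂ s hs').trans (le_max_right _ _))
    rw [EuclideanSpace.real_norm_sq_eq]
    refine (Finset.sum_le_sum hj).trans (le_of_eq ?_)
    simp
  have hsum := summable_freqSq_rpow (d := d) (r := 1 - α) (by linarith)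
  have hp : (0 : ℝ) < (2 * Real.pi) ^ d := by positivity
  have hgron : ∀ t ∈ Set.Icc 0 T,
      G t ≤ (((2 * Real.pi) ^ d)⁻¹ * (d * L / ν) * ∑' n : Fin d → ℤ, freqSq n ^ (1 - α))
        * ∫ s in (0 : ℝ)..t, G s := by
    intro t ht
    have h1 : (2 * Real.pi) ^ d * G t
        ≤ (d * L / ν * ∫ s in (0 : ℝ)..t, G s) * ∑' n : Fin d → ℤ, freqSq n ^ (1 - α) := by
      refine hasSum_le (fun n => ?_) (hw t).hasSum_gradSq (hsum.hasSum.mul_left _)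
      by_cases hn : n = 0
      · subst hn
        have h0 : freqSq (0 : Fin d → ℤ) = 0 := by simp [freqSq]
        rw [h0, zero_mul]
        have := hI0 t ht
        have := Real.rpow_nonneg (le_refl (0 : ℝ)) (1 - α)
        positivity
      · have hc0 := hcoeff n hn 0 (by simp) t ht
        have hc1 := hcoeff n hn (Real.pi / 2) (by simp) t ht
        have hpos := freqSq_pos hn
        have hpos' := Real.rpow_pos_of_pos hpos α
        calc freqSq n * modeSq n ((u t - v t : H d) : L2Field d)
            ≤ freqSq n * (2 * (d * ((2 * (ν * freqSq n ^ α))⁻¹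
              * (L * ∫ s in (0 : ℝ)..t, G s)))) := by
              refine mul_le_mul_of_nonneg_left ?_ hpos.le
              rw [modeSq]
              linarith
          _ = _ := by
              rw [Real.rpow_sub hpos, Real.rpow_one]
              field_simp
    rw [mul_assoc, mul_assoc, ← div_eq_inv_mul, le_div_iff₀ hp]
    linarith
  intro t ht
  have h0 := eq_zero_of_le_integral hG hG0 hgron t ht
  have h1 := (hw t).norm_sq_le_gradSq
  rw [show gradSq (u t - v t) = 0 from h0] at h1
  have h2 : ‖u t - v t‖ = 0 := by
    have := norm_nonneg (u t - v t)
    nlinarith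
  exact sub_eq_zero.1 (norm_eq_zero.1 h2)

/-! ### Pathwise uniqueness -/

/-- The path `u` on `[0,T]`, extended by its end values to all of `ℝ`. -/
def clampPath {d : ℕ} {T : ℝ} (hT : 0 ≤ T) (u : ℝ → H d) (t : ℝ) : H d :=
  u (Set.projIcc 0 T hT t)

lemma clampPath_of_mem {d : ℕ} {T : ℝ} (hT : 0 ≤ T) (u : ℝ → H d) {t : ℝ}
    (ht : t ∈ Set.Icc 0 T) : clampPath hT u t = u t := by
  rw [clampPath, Set.projIcc_of_mem hT ht]

lemma IsDomainPath.exists_clampPath {d : ℕ} {T : ℝ} {u : ℝ → H d} (h : IsDomainPath T u)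
    (hT : 0 ≤ T) :
    ∃ Au : ℝ → H d, (∀ t, IsStokes (clampPath hT u t) (Au t)) ∧ Continuous Au := by
  obtain ⟨Au, hAu, hc⟩ := h
  exact ⟨clampPath hT Au, fun t => hAu _ (Set.projIcc 0 T hT t).2,
    hc.comp_continuous (continuous_subtype_val.comp continuous_projIcc)
      fun t => (Set.projIcc 0 T hT t).2⟩

/-- The equation for a Fourier mode of the difference of two solutions driven by the same noise
`W`, given the equations of both solutions at the time `t`. -/
lemma inner_sub_clampPath_eq {d : ℕ} {T ν α : ℝ} (hT : 0 ≤ T) {u v Au Av : ℝ → H d}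
    (hu : ∀ t, IsStokes (clampPath hT u t) (Au t)) (hAu : Continuous Au)
    (hv : ∀ t, IsStokes (clampPath hT v t) (Av t)) (hAv : Continuous Av)
    {n : Fin d → ℤ} (hn : n ≠ 0) (b : ℝ) (j : Fin d) (x W : ℝ) {t : ℝ} (ht : t ∈ Set.Icc 0 T)
    (hue : ⟪u t, testField hn b j⟫_ℝ = x
      - ν * (∫ s in (0 : ℝ)..t, ⟪u s, freqSq n ^ α • testField hn b j⟫_ℝ)
      - (∫ s in (0 : ℝ)..t, bform (u s) (u s) (testField hn b j)) + W)
    (hve : ⟪v t, testField hn b j⟫_ℝ = x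
      - ν * (∫ s in (0 : ℝ)..t, ⟪v s, freqSq n ^ α • testField hn b j⟫_ℝ)
      - (∫ s in (0 : ℝ)..t, bform (v s) (v s) (testField hn b j)) + W) :
    ⟪clampPath hT u t - clampPath hT v t, testField hn b j⟫_ℝ
      = -(ν * freqSq n ^ α) * (∫ s in (0 : ℝ)..t,
          ⟪clampPath hT u s - clampPath hT v s, testField hn b j⟫_ℝ)
        - ∫ s in (0 : ℝ)..t, (bform (clampPath hT u s) (clampPath hT u s) (testField hn b j)
          - bform (clampPath hT v s) (clampPath hT v s) (testField hn b j)) := by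
  have hz := norm_testField_le hn b j
  have hmem : ∀ s ∈ Set.uIcc 0 t, s ∈ Set.Icc 0 T := fun s hs => by
    rw [Set.uIcc_of_le ht.1] at hs
    exact ⟨hs.1, hs.2.trans ht.2⟩
  have hlin : ∀ w : ℝ → H d, (∫ s in (0 : ℝ)..t, ⟪w s, freqSq n ^ α • testField hn b j⟫_ℝ)
      = freqSq n ^ α * ∫ s in (0 : ℝ)..t, ⟪clampPath hT w s, testField hn b j⟫_ℝ := by
    intro w
    rw [← intervalIntegral.integral_const_mul]
    refine intervalIntegral.integral_congr fun s hs => ?_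
    simp only [clampPath_of_mem hT w (hmem s hs)]
    exact real_inner_smul_right (w s) (testField hn b j) (freqSq n ^ α)
  have hbil : ∀ w : ℝ → H d, (∫ s in (0 : ℝ)..t, bform (w s) (w s) (testField hn b j))
      = ∫ s in (0 : ℝ)..t, bform (clampPath hT w s) (clampPath hT w s) (testField hn b j) := by
    intro w
    refine intervalIntegral.integral_congr fun s hs => ?_
    simp only [clampPath_of_mem hT w (hmem s hs)]
  rw [hlin, hbil, ← clampPath_of_mem hT u ht] at hue
  rw [hlin, hbil, ← clampPath_of_mem hT v ht] at hve
  have hcu : Continuous fun s => ⟪clampPath hT u s, testField hn b j⟫_ℝ :=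
    (continuous_of_isStokes hu hAu).inner continuous_const
  have hcv : Continuous fun s => ⟪clampPath hT v s, testField hn b j⟫_ℝ :=
    (continuous_of_isStokes hv hAv).inner continuous_const
  simp only [inner_sub_left]
  rw [intervalIntegral.integral_sub (hcu.intervalIntegrable _ _) (hcv.intervalIntegrable _ _),
    intervalIntegral.integral_sub ((continuous_bform hz hu hAu).intervalIntegrable _ _)
      ((continuous_bform hz hv hAv).intervalIntegrable _ _), hue, hve]
  ring

/-- Two continuous functions on `ℝ` which agree on a dense sequence of `[0,T]` agree on `[0,T]`. -/
lemma eqOn_Icc_of_denseRange {T : ℝ} {τ : ℕ → Set.Icc (0 : ℝ) T} (hτ : DenseRange τ)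
    {f g : ℝ → ℝ} (hf : Continuous f) (hg : Continuous g) (h : ∀ k, f (τ k) = g (τ k)) :
    ∀ t ∈ Set.Icc 0 T, f t = g t := fun t ht =>
  congrFun (hτ.equalizer (hf.comp continuous_subtype_val) (hg.comp continuous_subtype_val)
    (funext h)) ⟨t, ht⟩

/-- Pathwise uniqueness in any dimension and for any power `γ` in the noise: the noise enters both
solutions through the same term and is only used through its pairing with the test fields. -/
theorem IsStrongSolution.ae_eq {d : ℕ} {ν α γ T : ℝ} (hν : 0 < ν) (hα : (d : ℝ) / 2 + 1 < α)
    (hT : 0 ≤ T) {Ω : Type*} [mΩ : MeasurableSpace Ω] {P : Measure Ω} {𝓕 : Filtration ℝ≥0 mΩ}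
    {w : ℝ≥0 → H d → Ω → ℝ} {x : H d} {u₁ u₂ : ℝ → Ω → H d}
    (hu₁ : IsStrongSolution P 𝓕 w ν α γ T x u₁) (hu₂ : IsStrongSolution P 𝓕 w ν α γ T x u₂) :
    ∀ᵐ ω ∂P, ∀ t ∈ Set.Icc 0 T, u₁ t ω = u₂ t ω := by
  have : Nonempty (Set.Icc (0 : ℝ) T) := ⟨⟨0, le_rfl, hT⟩⟩
  -- The exceptional set of the equation depends on the test field and on the time; countably
  -- many of both are used, and the remaining times are reached by continuity.
  let τ := TopologicalSpace.denseSeq (Set.Icc (0 : ℝ) T)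
  have hmodes : ∀ {u : ℝ → Ω → H d}, IsStrongSolution P 𝓕 w ν α γ T x u →
      ∀ᵐ ω ∂P, ∀ n : {n : Fin d → ℤ // n ≠ 0}, ∀ b ∈ ({0, Real.pi / 2} : Set ℝ),
        ∀ (j : Fin d) (k : ℕ), ⟪u (τ k) ω, testField n.2 b j⟫_ℝ
          = ⟪x, testField n.2 b j⟫_ℝ
            - ν * (∫ s in (0 : ℝ)..τ k, ⟪u s ω, freqSq n.1 ^ α • testField n.2 b j⟫_ℝ)
            - (∫ s in (0 : ℝ)..τ k, bform (u s ω) (u s ω) (testField n.2 b j))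
            + w ⟨τ k, (τ k).2.1⟩ (freqSq n.1 ^ γ • testField n.2 b j) ω := by
    intro u hu
    refine ae_all_iff.2 fun n => (ae_ball_iff (Set.toFinite _).countable).2 fun b _ =>
      ae_all_iff.2 fun j => ae_all_iff.2 fun k => ?_
    exact hu.equation _ _ _ (isStokesPow_testField n.2 b j α)
      (isStokesPow_testField n.2 b j γ) ⟨τ k, (τ k).2.1⟩ (τ k).2.2
  filter_upwards [hu₁.paths, hu₂.paths, hmodes hu₁, hmodes hu₂] with ω hp₁ hp₂ he₁ he₂
  obtain ⟨A₁, hA₁, hc₁⟩ := hp₁.exists_clampPath hT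
  obtain ⟨A₂, hA₂, hc₂⟩ := hp₂.exists_clampPath hT
  have key := eq_of_mode_equations hν hα hA₁ hc₁ hA₂ hc₂ (T := T) fun n hn b hb j => by
    have hz := norm_testField_le hn b j
    have hcont := ((continuous_of_isStokes hA₁ hc₁).sub
      (continuous_of_isStokes hA₂ hc₂)).inner (continuous_const (y := testField hn b j)) (𝕜 := ℝ)
    have hcN := (continuous_bform hz hA₁ hc₁).sub (continuous_bform hz hA₂ hc₂)
    refine eqOn_Icc_of_denseRange (TopologicalSpace.denseRange_denseSeq _) hcont
      ((continuous_const.mul (intervalIntegral.continuous_primitive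
        (fun _ _ => hcont.intervalIntegrable _ _) 0)).sub
        (intervalIntegral.continuous_primitive (fun _ _ => hcN.intervalIntegrable _ _) 0))
      fun k => ?_
    exact inner_sub_clampPath_eq hT hA₁ hc₁ hA₂ hc₂ hn b j _ _ (τ k).2
      (he₁ ⟨n, hn⟩ b hb j k) (he₂ ⟨n, hn⟩ b hb j k)
  intro t ht
  have h := key t ht
  rwa [clampPath_of_mem hT _ ht, clampPath_of_mem hT _ ht] at h

end ModifiedNS

end

theorem mainTheorem5 (d : ℕ) (hd : d = 2 ∨ d = 3) (ν α T : ℝ) (hν : 0 < ν)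
    (hα : (d : ℝ) / 2 + 1 < α) (hT : 0 < T)
    {Ω : Type*} [mΩ : MeasurableSpace Ω] (P : Measure Ω) [IsProbabilityMeasure P]
    (𝓕 : Filtration ℝ≥0 mΩ) (w : ℝ≥0 → ModifiedNS.H d → Ω → ℝ)
    (hw : ModifiedNS.IsCylindricalWiener P 𝓕 w)
    (x : ModifiedNS.H d) (hx : x ∈ ModifiedNS.stokesDomain d)
    (u₁ u₂ : ℝ → Ω → ModifiedNS.H d)
    (hu₁ : ModifiedNS.IsStrongSolution P 𝓕 w ν α (-1 / 2) T x u₁)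
    (hu₂ : ModifiedNS.IsStrongSolution P 𝓕 w ν α (-1 / 2) T x u₂) :
    ∀ᵐ ω ∂P, ∀ t ∈ Set.Icc 0 T, u₁ t ω = u₂ t ω := by
  exact hu₁.ae_eq hν hα hT.le hu₂
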